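/- Let $k$ be an algebraically closed field and let $A$ be a finite dimensional (associative, unital) $k$-algebra. Write $\mathsf{D}^{\mathrm b}(A)$ for the bounded derived category of the abelian category of finite dimensional $A$-modules. For a triangulated category $\mathsf{T}$, a thick subcategory is a full triangulated subcategory closed under direct summands, and $\mathrm{Thick}(\mathsf{T})$ denotes the complete lattice of thick subcategories of $\mathsf{T}$ ordered by inclusion: the meet is given by intersection, and the join of a family is the smallest thick subcategory containing its union. Then the following are equivalent: 1. the lattice $\mathrm{Thick}(\mathsf{D}^{\mathrm b}(A))$ is distributive; 2. there are finitely many finite dimensional local $k$-algebras $A_1,\dots,A_n$ ($n\ge 0$) such that $A$ is Morita equivalent (over $k$) to the product $A_1\times\cdots\times A_n$ and, for each $i$, the lattice $\mathrm{Thick}(\mathsf{D}^{\mathrm b}(A_i))$ is distributive. -/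

import Mathlib

open CategoryTheory

universe v u

/-- A thick subcategory of a triangulated category `T`: a (strictly) full triangulated subcategory
closed under retracts, i.e. under direct summands. It is given by its class of objects. -/
@[ext]
structure ThickSubcategory (T : Type u) [Category.{v} T] [Limits.HasZeroObject T] [HasShift T ℤ]
    [Preadditive T] [∀ n : ℤ, (shiftFunctor T n).Additive] [Pretriangulated T] where
  /-- the property of belonging to the subcategory -/
  prop : ObjectProperty T
  isTriangulated : prop.IsTriangulated
  isStableUnderRetracts : prop.IsStableUnderRetracts

namespace ThickSubcategory

variable {T : Type u} [Category.{v} T] [Limits.HasZeroObject T] [HasShift T ℤ]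
  [Preadditive T] [∀ n : ℤ, (shiftFunctor T n).Additive] [Pretriangulated T]

/-- Thick subcategories are ordered by inclusion. -/
instance : PartialOrder (ThickSubcategory T) :=
  PartialOrder.lift ThickSubcategory.prop fun _ _ h => ThickSubcategory.ext h

/-- The intersection of a family of thick subcategories. -/
def inter (S : Set (ThickSubcategory T)) : ThickSubcategory T where
  prop X := ∀ P ∈ S, P.prop X
  isStableUnderRetracts :=
    { of_retract := fun r h P hP => P.isStableUnderRetracts.of_retract r (h P hP) }
  isTriangulated :=
    { exists_zero := by
        refine ⟨_, Limits.isZero_zero T, fun P hP => ?_⟩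
        have := P.isTriangulated
        have := P.isStableUnderRetracts
        exact P.prop.prop_zero
      isStableUnderShiftBy := fun n =>
        { le_shift := fun X hX P hP => by
            have := P.isTriangulated
            exact P.prop.le_shift n X (hX P hP) }
      ext₂' := fun t ht h₁ h₃ => by
        refine ObjectProperty.le_isoClosure _ _ fun P hP => ?_
        have := P.isTriangulated
        have := P.isStableUnderRetracts
        exact P.prop.ext_of_isTriangulatedClosed₂ t ht (h₁ P hP) (h₃ P hP) }

instance : InfSet (ThickSubcategory T) := ⟨inter⟩

/-- The complete lattice `Thick(T)`: the meet of thick subcategories is their intersection, and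
their join is the smallest thick subcategory containing all of them. -/
instance : CompleteLattice (ThickSubcategory T) :=
  completeLatticeOfInf _ fun _ =>
    ⟨fun _ hP _ hX => hX _ hP, fun _ hQ X hX _ hP => hQ hP X hX⟩

theorem inf_prop (P Q : ThickSubcategory T) : (P ⊓ Q).prop = P.prop ⊓ Q.prop := by
  apply le_antisymm
  · exact fun X hX => ⟨(inf_le_left : P ⊓ Q ≤ P) X hX, (inf_le_right : P ⊓ Q ≤ Q) X hX⟩
  · rintro X ⟨hP, hQ⟩ R (rfl | rfl)
    exacts [hP, hQ]

end ThickSubcategory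

/-- A lattice is distributive if `x ∧ (y ∨ z) = (x ∧ y) ∨ (x ∧ z)` for all `x`, `y`, `z`. -/
def IsDistributiveLattice (L : Type u) [Lattice L] : Prop :=
  ∀ x y z : L, x ⊓ (y ⊔ z) = (x ⊓ y) ⊔ (x ⊓ z)

/-- We choose the standard construction of the derived category of the abelian category of
finitely generated left modules over a left Noetherian ring. -/
noncomputable instance (A : Type u) [Ring A] [IsNoetherianRing A] :
    HasDerivedCategory.{u + 1} (FGModuleCat.{u} A) :=
  HasDerivedCategory.standard _

/-- The bounded derived category of the abelian category of finitely generated left `A`-modules.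
When `A` is a finite dimensional algebra over a field, these are the finite dimensional
`A`-modules. -/
abbrev BoundedDerivedCategory (A : Type u) [Ring A] [IsNoetherianRing A] : Type (u + 1) :=
  DerivedCategory.Bounded (FGModuleCat.{u} A)

/-- For a finite dimensional `k`-algebra `A`: the lattice of thick subcategories of the bounded
derived category of finite dimensional `A`-modules is distributive. -/
def HasDistributiveThickDb (k : Type v) [Field k] (A : Type u) [Ring A] [Algebra k A]
    [FiniteDimensional k A] : Prop :=
  haveI : IsNoetherianRing A := IsNoetherianRing.of_finite k A
  IsDistributiveLattice (ThickSubcategory (BoundedDerivedCategory A))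

/-!
Both implications rest on the fact that `Thick(D^b(A))` only depends on the module category of `A`
and turns finite products of algebras into products of lattices: if `A` is Morita equivalent to
`B₁ × ⋯ × Bₙ`, then `Thick(D^b(A))` is the product of the lattices `Thick(D^b(Bᵢ))`, and a product
of nonempty lattices is distributive exactly when each factor is
(`hasDistributiveThickDb_iff_of_isMoritaEquivalent_pi`). Equivalences of module categories and
product decompositions are treated together, as orthogonal decompositions by exact functors
(`DerivedCategory.thickBoundedOrderIsoPi`); an equivalence has a single summand, and it preserves
finite generation because over a Noetherian ring this is the ascending chain condition.

It remains to see that distributivity makes `A` Morita equivalent to a product of local algebras.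
Write `A` as a direct sum of indecomposable projective modules. These have local endomorphism
rings, by Fitting's lemma, and hence a unique simple quotient each, which determines them. Let `Q`
be one of them, with simple quotient `S`, and let `y` and `z` be the thick subcategories generated
by `S` and by the other simple modules. By dévissage `y ⊔ z = ⊤`. The left orthogonal `x` of the
simple modules other than `S` satisfies `x ⊓ z = ⊥` and contains `Q`. Distributivity gives
`x = x ⊓ (y ⊔ z) = (x ⊓ y) ⊔ (x ⊓ z) = x ⊓ y`, so `Q` lies in `y`. An indecomposable projective
module `P` not isomorphic to `Q` is orthogonal to all shifts of `S`, hence to all of `y`, and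
therefore every morphism from `P` to `Q` vanishes
(`DerivedCategory.Bounded.hom_eq_zero_of_isDistributiveLattice`). Grouping the summands of `A` by
isomorphism class, the endomorphism algebra of `A` becomes a product of matrix algebras over the
local algebras `End(Q)`, and `A` is Morita equivalent to the product of their opposites
(`exists_isMoritaEquivalent_pi_isLocalRing`).
-/

/-! ### Distributive lattices -/

theorem IsDistributiveLattice.of_orderIso {L M : Type*} [Lattice L] [Lattice M] (e : L ≃o M)
    (h : IsDistributiveLattice L) : IsDistributiveLattice M := fun x y z => by
  apply e.symm.injective
  simp only [map_inf, map_sup]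
  exact h _ _ _

theorem isDistributiveLattice_pi_iff {ι : Type*} {L : ι → Type*} [∀ i, Lattice (L i)]
    [∀ i, Nonempty (L i)] :
    IsDistributiveLattice (∀ i, L i) ↔ ∀ i, IsDistributiveLattice (L i) := by
  classical
  refine ⟨fun h i x y z => ?_, fun h x y z => funext fun i => h i _ _ _⟩
  -- embed the three elements in the factor `i`, with an arbitrary base point elsewhere
  let c : ∀ i, L i := fun _ => Classical.arbitrary _
  simpa using congrFun (h (Function.update c i x) (Function.update c i y)
    (Function.update c i z)) i

/-! ### Functoriality of the lattice of thick subcategories -/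

namespace ThickSubcategory

open Limits

variable {T : Type*} [Category* T] [HasZeroObject T] [HasShift T ℤ]
  [Preadditive T] [∀ n : ℤ, (shiftFunctor T n).Additive] [Pretriangulated T]
  {T' : Type*} [Category* T'] [HasZeroObject T'] [HasShift T' ℤ]
  [Preadditive T'] [∀ n : ℤ, (shiftFunctor T' n).Additive] [Pretriangulated T']

instance (P : ThickSubcategory T) : P.prop.IsTriangulated := P.isTriangulated

instance (P : ThickSubcategory T) : P.prop.IsStableUnderRetracts := P.isStableUnderRetracts

/-- The inverse image of a thick subcategory under a triangulated functor. -/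
def comap (F : T ⥤ T') [F.CommShift ℤ] [F.IsTriangulated] (P : ThickSubcategory T') :
    ThickSubcategory T where
  prop := P.prop.inverseImage F
  isTriangulated := inferInstance
  isStableUnderRetracts :=
    { of_retract := fun r h => P.prop.prop_of_retract (r.map F) h }

theorem prop_biproduct (P : ThickSubcategory T) [HasFiniteBiproducts T] {ι : Type} [Finite ι]
    (f : ι → T) (h : ∀ i, P.prop (f i)) : P.prop (⨁ f) := by
  exact P.prop.prop_of_isLimit (biproduct.isLimit f) fun j => h j.as

theorem iInf_prop {ι : Sort*} (Q : ι → ThickSubcategory T) (X : T) :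
    (⨅ i, Q i).prop X ↔ ∀ i, (Q i).prop X :=
  Set.forall_mem_range (p := fun P : ThickSubcategory T => P.prop X)

/-- An object is a retract of a direct sum as soon as its identity is a sum of composites. -/
theorem prop_of_sum_eq_id (P : ThickSubcategory T) {ι : Type} [Fintype ι] {X : T} (Y : ι → T)
    (h : ∀ i, P.prop (Y i)) (a : ∀ i, Y i ⟶ X) (b : ∀ i, X ⟶ Y i)
    (hab : ∑ i, b i ≫ a i = 𝟙 X) : P.prop X := by
  have : HasFiniteBiproducts T := HasFiniteBiproducts.of_hasFiniteProducts
  exact P.prop.prop_of_retract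
    { i := biproduct.lift b, r := biproduct.desc a, retract := biproduct.lift_desc.trans hab }
    (P.prop_biproduct Y h)

/-- A triangulated category `T` which is the orthogonal sum of finitely many triangulated
categories `T' i`, with inclusions `F i` and projections `G i`, has as lattice of thick
subcategories the product of the lattices of thick subcategories of the `T' i`. -/
def orderIsoPi {ι : Type} [Fintype ι] {T' : ι → Type*} [∀ i, Category* (T' i)]
    [∀ i, HasZeroObject (T' i)] [∀ i, HasShift (T' i) ℤ] [∀ i, Preadditive (T' i)]
    [∀ i, ∀ n : ℤ, (shiftFunctor (T' i) n).Additive] [∀ i, Pretriangulated (T' i)]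
    (F : ∀ i, T' i ⥤ T) [∀ i, (F i).CommShift ℤ] [∀ i, (F i).IsTriangulated]
    (G : ∀ i, T ⥤ T' i) [∀ i, (G i).CommShift ℤ] [∀ i, (G i).IsTriangulated]
    (hGF : ∀ i X, Nonempty ((G i).obj ((F i).obj X) ≅ X))
    (hne : ∀ i j, i ≠ j → ∀ X, IsZero ((G j).obj ((F i).obj X)))
    (hFG : ∀ X, ∃ (a : ∀ i, (F i).obj ((G i).obj X) ⟶ X) (b : ∀ i, X ⟶ (F i).obj ((G i).obj X)),
      (∀ i, a i ≫ b i = 𝟙 _) ∧ ∑ i, b i ≫ a i = 𝟙 X) :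
    ThickSubcategory T ≃o ∀ i, ThickSubcategory (T' i) where
  toFun P i := P.comap (F i)
  invFun Q := ⨅ i, (Q i).comap (G i)
  left_inv P := ThickSubcategory.ext <| funext fun X => propext <| by
    rw [iInf_prop]
    obtain ⟨a, b, hab, hba⟩ := hFG X
    exact ⟨fun h => P.prop_of_sum_eq_id _ h a b hba,
      fun h i => P.prop.prop_of_retract ⟨a i, b i, hab i⟩ h⟩
  right_inv Q := funext fun j => ThickSubcategory.ext <| funext fun X => propext <| by
    refine (iInf_prop _ _).trans ⟨fun h => ?_, fun h i => ?_⟩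
    · exact (Q j).prop.prop_of_iso (hGF j X).some (h j)
    · by_cases hij : j = i
      · subst hij
        exact (Q j).prop.prop_of_iso (hGF j X).some.symm h
      · exact (Q i).prop.prop_of_isZero (hne j i hij X)
  map_rel_iff' {P Q} := by
    refine ⟨fun h X hX => ?_, fun h i X hX => h _ hX⟩
    obtain ⟨a, b, hab, hba⟩ := hFG X
    exact Q.prop_of_sum_eq_id _
      (fun i => h i _ (P.prop.prop_of_retract ⟨a i, b i, hab i⟩ hX)) a b hba

end ThickSubcategory

/-! ### Exact functors and bounded derived categories -/

namespace CategoryTheory.Functor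

open Limits _root_.DerivedCategory

universe w₁ w₂ v₁ v₂ u₁ u₂

variable {C₁ : Type u₁} [Category.{v₁} C₁] [Abelian C₁] [HasDerivedCategory.{w₁} C₁]
  {C₂ : Type u₂} [Category.{v₂} C₂] [Abelian C₂] [HasDerivedCategory.{w₂} C₂]
  (F : C₁ ⥤ C₂) [F.Additive] [PreservesFiniteLimits F] [PreservesFiniteColimits F]

theorem bounded_mapDerivedCategory_obj {X : DerivedCategory C₁}
    (hX : (TStructure.t : Triangulated.TStructure (DerivedCategory C₁)).bounded X) :
    (TStructure.t : Triangulated.TStructure (DerivedCategory C₂)).bounded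
      (F.mapDerivedCategory.obj X) := by
  obtain ⟨⟨a, ⟨K, e, hK⟩⟩, ⟨b, ⟨L, e', hL⟩⟩⟩ := hX
  exact ⟨⟨a, ⟨(F.mapHomologicalComplex _).obj K,
      F.mapDerivedCategory.mapIso e ≪≫ F.mapDerivedCategoryFactors.app K,
      inferInstanceAs (HomologicalComplex.IsStrictlySupported _ _)⟩⟩,
    ⟨b, ⟨(F.mapHomologicalComplex _).obj L,
      F.mapDerivedCategory.mapIso e' ≪≫ F.mapDerivedCategoryFactors.app L,
      inferInstanceAs (HomologicalComplex.IsStrictlySupported _ _)⟩⟩⟩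

/-- The triangulated functor between bounded derived categories induced by an exact functor. -/
noncomputable def mapDerivedCategoryBounded : Bounded C₁ ⥤ Bounded C₂ :=
  TStructure.t.bounded.lift (Bounded.ι ⋙ F.mapDerivedCategory)
    fun X => F.bounded_mapDerivedCategory_obj X.property

noncomputable instance : F.mapDerivedCategoryBounded.CommShift ℤ :=
  inferInstanceAs ((TStructure.t.bounded.lift (Bounded.ι ⋙ F.mapDerivedCategory)
    fun X => F.bounded_mapDerivedCategory_obj X.property).CommShift ℤ)

instance : F.mapDerivedCategoryBounded.IsTriangulated :=
  inferInstanceAs ((TStructure.t.bounded.lift (Bounded.ι ⋙ F.mapDerivedCategory)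
    fun X => F.bounded_mapDerivedCategory_obj X.property).IsTriangulated)

end CategoryTheory.Functor

namespace DerivedCategory

open Limits

universe w₁ w₂ w₃ v₁ v₂ v₃ u₁ u₂ u₃

section

variable {C₁ : Type u₁} [Category.{v₁} C₁] [Abelian C₁] [HasDerivedCategory.{w₁} C₁]
  {C₂ : Type u₂} [Category.{v₂} C₂] [Abelian C₂] [HasDerivedCategory.{w₂} C₂]
  {C₃ : Type u₃} [Category.{v₃} C₃] [Abelian C₃] [HasDerivedCategory.{w₃} C₃]
  (F : C₁ ⥤ C₂) [F.Additive] [PreservesFiniteLimits F] [PreservesFiniteColimits F]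
  (G : C₂ ⥤ C₃) [G.Additive] [PreservesFiniteLimits G] [PreservesFiniteColimits G]

/-- The composite of the functors induced by two exact functors, evaluated on the object of the
derived category given by a complex. -/
noncomputable def mapDerivedCategoryCompObjIso {X : DerivedCategory C₁} {K : CochainComplex C₁ ℤ}
    (e : Q.obj K ≅ X) :
    G.mapDerivedCategory.obj (F.mapDerivedCategory.obj X) ≅
      Q.obj ((G.mapHomologicalComplex _).obj ((F.mapHomologicalComplex _).obj K)) :=
  G.mapDerivedCategory.mapIso (F.mapDerivedCategory.mapIso e.symm ≪≫
    F.mapDerivedCategoryFactors.app K) ≪≫ G.mapDerivedCategoryFactors.app _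

end

/-- If an abelian category `C` is the orthogonal sum of finitely many abelian categories `C' i`,
with exact inclusions `F i` and exact projections `G i`, then the lattice of thick subcategories
of its bounded derived category is the product of the lattices of thick subcategories of the
bounded derived categories of the `C' i`. -/
noncomputable def thickBoundedOrderIsoPi {ι : Type} [Fintype ι]
    {C : Type u₁} [Category.{v₁} C] [Abelian C] [HasDerivedCategory.{w₁} C]
    {C' : ι → Type u₂} [∀ i, Category.{v₂} (C' i)] [∀ i, Abelian (C' i)]
    [∀ i, HasDerivedCategory.{w₂} (C' i)]
    (F : ∀ i, C' i ⥤ C) [∀ i, (F i).Additive] [∀ i, PreservesFiniteLimits (F i)]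
    [∀ i, PreservesFiniteColimits (F i)]
    (G : ∀ i, C ⥤ C' i) [∀ i, (G i).Additive] [∀ i, PreservesFiniteLimits (G i)]
    [∀ i, PreservesFiniteColimits (G i)]
    (hGF : ∀ i, F i ⋙ G i ≅ 𝟭 _)
    (hne : ∀ i j, i ≠ j → ∀ X, IsZero ((G j).obj ((F i).obj X)))
    (a : ∀ i, G i ⋙ F i ⟶ 𝟭 C) (b : ∀ i, 𝟭 C ⟶ G i ⋙ F i)
    (hab : ∀ i X, (a i).app X ≫ (b i).app X = 𝟙 _)
    (hba : ∀ X, ∑ i, (b i).app X ≫ (a i).app X = 𝟙 _) :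
    ThickSubcategory (Bounded C) ≃o ∀ i, ThickSubcategory (Bounded (C' i)) :=
  ThickSubcategory.orderIsoPi (fun i => (F i).mapDerivedCategoryBounded)
    (fun i => (G i).mapDerivedCategoryBounded)
    (fun i X => ⟨Bounded.ι.preimageIso
      (mapDerivedCategoryCompObjIso (F i) (G i) (Q.objObjPreimageIso X.obj) ≪≫
      Q.mapIso ((NatIso.mapHomologicalComplex (hGF i) _).app _) ≪≫
      Q.objObjPreimageIso X.obj)⟩)
    (fun i j hij X => by
      refine IsZero.of_full_of_faithful_of_isZero Bounded.ι _ (IsZero.of_iso ?_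
        (mapDerivedCategoryCompObjIso (F i) (G j) (Q.objObjPreimageIso X.obj)))
      refine Q.map_isZero ((IsZero.iff_id_eq_zero _).2 ?_)
      ext n
      exact (hne i j hij _).eq_of_src _ _)
    -- the natural transformations `a i` and `b i`, applied degreewise to a complex representing `X`
    (fun X => by
      let K := Q.objPreimage X.obj
      let e : Q.obj K ≅ Bounded.ι.obj X := Q.objObjPreimageIso X.obj
      let M : ι → CochainComplex C ℤ := fun i =>
        ((F i).mapHomologicalComplex _).obj (((G i).mapHomologicalComplex _).obj K)
      let θ : ∀ i, Bounded.ι.obj ((F i).mapDerivedCategoryBounded.obj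
          ((G i).mapDerivedCategoryBounded.obj X)) ≅ Q.obj (M i) :=
        fun i => mapDerivedCategoryCompObjIso (G i) (F i) e
      let α : ∀ i, M i ⟶ K := fun i =>
        { f := fun n => (a i).app _, comm' := fun _ _ _ => ((a i).naturality _).symm }
      let β : ∀ i, K ⟶ M i := fun i =>
        { f := fun n => (b i).app _, comm' := fun _ _ _ => ((b i).naturality _).symm }
      have hαβ : ∀ i, α i ≫ β i = 𝟙 _ := fun i => by
        ext n
        exact hab i _
      have hβα : ∑ i, β i ≫ α i = 𝟙 _ := by
        ext n
        exact ((HomologicalComplex.eval C _ n).map_sum _ _).trans (hba (K.X n))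
      refine ⟨fun i => Bounded.ι.preimage ((θ i).hom ≫ Q.map (α i) ≫ e.hom),
        fun i => Bounded.ι.preimage (e.inv ≫ Q.map (β i) ≫ (θ i).inv), fun i => ?_, ?_⟩
      · apply Bounded.ι.map_injective
        rw [Functor.map_comp, Functor.map_preimage, Functor.map_preimage, CategoryTheory.Functor.map_id]
        have h : Q.map (α i) ≫ Q.map (β i) = 𝟙 _ := by rw [← Q.map_comp, hαβ, Q.map_id]
        simp only [Category.assoc, e.hom_inv_id_assoc, reassoc_of% h, Iso.hom_inv_id]
      · apply Bounded.ι.map_injective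
        rw [Functor.map_sum, CategoryTheory.Functor.map_id]
        have h : ∑ i, Q.map (β i) ≫ Q.map (α i) = 𝟙 _ := by
          simp only [← Q.map_comp, ← Functor.map_sum, hβα, Q.map_id]
        simp only [Functor.map_comp, Functor.map_preimage, Category.assoc, Iso.inv_hom_id_assoc]
        rw [← Preadditive.comp_sum]
        simp only [← Category.assoc (Q.map (β _)), ← Preadditive.sum_comp, h]
        simp)

end DerivedCategory

/-! ### Finitely generated modules under equivalences of module categories -/

theorem OrderIso.wellFoundedGT_congr {α β : Type*} [Preorder α] [Preorder β] (e : α ≃o β) :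
    WellFoundedGT α ↔ WellFoundedGT β :=
  ⟨fun _ => e.symm.strictMono.wellFoundedGT, fun _ => e.strictMono.wellFoundedGT⟩

namespace ModuleCat

instance {A : Type u} [Ring A] : (isFG.{u} A).IsClosedUnderIsomorphisms where
  of_iso e (_ : Module.Finite A _) := Module.Finite.equiv e.toLinearEquiv

/-- Over a left Noetherian ring, the finitely generated modules are the modules satisfying the
ascending chain condition on subobjects. -/
theorem isFG_iff_wellFoundedGT_subobject {A : Type u} [Ring A] [IsNoetherianRing A]
    (M : ModuleCat.{u} A) : isFG A M ↔ WellFoundedGT (Subobject M) := by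
  rw [isFG_iff, (subobjectModule M).wellFoundedGT_congr, ← isNoetherian_iff']
  exact ⟨fun _ => inferInstance, fun _ => inferInstance⟩

theorem inverseImage_isFG_of_equivalence {A B : Type u} [Ring A] [IsNoetherianRing A] [Ring B]
    [IsNoetherianRing B] (E : ModuleCat.{u} A ≌ ModuleCat.{u} B) :
    (isFG.{u} B).inverseImage E.functor = isFG.{u} A := by
  ext M
  -- the ascending chain condition on subobjects is invariant under equivalence
  rw [ObjectProperty.prop_inverseImage_iff, isFG_iff_wellFoundedGT_subobject,
    isFG_iff_wellFoundedGT_subobject]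
  let e : Subobject M ≃o Subobject (E.functor.obj M) :=
    (Subobject.lowerEquivalence (MonoOver.congr M E)).toOrderIso
  exact e.wellFoundedGT_congr.symm

end ModuleCat

namespace FGModuleCat

open Limits

variable {A B : Type u} [Ring A] [Ring B]

/-- The functor between categories of finitely generated modules induced by a functor between
module categories which preserves finite generation. -/
def liftFunctor (F : ModuleCat.{u} A ⥤ ModuleCat.{u} B)
    (hF : ∀ M, ModuleCat.isFG A M → ModuleCat.isFG B (F.obj M)) :
    FGModuleCat.{u} A ⥤ FGModuleCat.{u} B :=
  (ModuleCat.isFG B).lift ((ModuleCat.isFG A).ι ⋙ F) fun M => hF _ M.property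

variable [IsNoetherianRing A] [IsNoetherianRing B] (F : ModuleCat.{u} A ⥤ ModuleCat.{u} B)
    (hF : ∀ M, ModuleCat.isFG A M → ModuleCat.isFG B (F.obj M))

instance : PreservesFiniteLimits (ModuleCat.isFG.{u} A).ι :=
  inferInstanceAs (PreservesFiniteLimits (forget₂ (FGModuleCat A) (ModuleCat.{u} A)))

instance : PreservesFiniteColimits (ModuleCat.isFG.{u} A).ι :=
  inferInstanceAs (PreservesFiniteColimits (forget₂ (FGModuleCat A) (ModuleCat.{u} A)))

instance [PreservesFiniteLimits F] : PreservesFiniteLimits (liftFunctor F hF) where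
  preservesFiniteLimits J _ _ :=
    have : PreservesLimitsOfShape J (liftFunctor F hF ⋙ (ModuleCat.isFG B).ι) :=
      inferInstanceAs (PreservesLimitsOfShape J ((ModuleCat.isFG A).ι ⋙ F))
    preservesLimitsOfShape_of_reflects_of_preserves _ (ModuleCat.isFG B).ι

instance [PreservesFiniteColimits F] : PreservesFiniteColimits (liftFunctor F hF) where
  preservesFiniteColimits J _ _ :=
    have : PreservesColimitsOfShape J (liftFunctor F hF ⋙ (ModuleCat.isFG B).ι) :=
      inferInstanceAs (PreservesColimitsOfShape J ((ModuleCat.isFG A).ι ⋙ F))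
    preservesColimitsOfShape_of_reflects_of_preserves _ (ModuleCat.isFG B).ι

instance [F.Additive] : (liftFunctor F hF).Additive where
  map_add {X Y f g} := by
    apply (ModuleCat.isFG B).ι.map_injective
    exact F.map_add

end FGModuleCat

/-- Equivalent module categories have isomorphic lattices of thick subcategories of bounded derived
categories of finitely generated modules. -/
theorem nonempty_thick_orderIso_of_equivalence {A B : Type u} [Ring A] [IsNoetherianRing A] [Ring B]
    [IsNoetherianRing B] (E : ModuleCat.{u} A ≌ ModuleCat.{u} B) :
    Nonempty (ThickSubcategory (BoundedDerivedCategory A) ≃o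
      ThickSubcategory (BoundedDerivedCategory B)) := by
  let E' : FGModuleCat.{u} A ≌ FGModuleCat.{u} B :=
    E.congrFullSubcategory (ModuleCat.inverseImage_isFG_of_equivalence E)
  have : E'.functor.Additive := E'.functor.additive_of_preserves_binary_products
  have : E'.inverse.Additive := E'.inverse.additive_of_preserves_binary_products
  exact ⟨(DerivedCategory.thickBoundedOrderIsoPi (ι := Unit) (C' := fun _ => FGModuleCat.{u} B)
    (fun _ => E'.inverse) (fun _ => E'.functor) (fun _ => E'.counitIso)
    (fun i j hij => (hij rfl).elim) (fun _ => E'.unitIso.inv) (fun _ => E'.unitIso.hom)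
    (fun _ X => E'.unitIso.inv_hom_id_app X) (fun X => by simp)).trans
    (OrderIso.funUnique Unit _)⟩

/-! ### Modules over a finite product of rings -/

namespace PiModule

variable {ι : Type} [DecidableEq ι] {B : ι → Type u} [∀ i, Ring (B i)]

section

variable (M : Type u) [AddCommGroup M] [Module (∀ i, B i) M] (i : ι)

/-- The component at `i` of a module over a product of rings: the image of the idempotent
supported at `i`. -/
def component : AddSubgroup M where
  carrier := {x | (Pi.single i (1 : B i) : ∀ i, B i) • x = x}
  add_mem' hx hy := by simp only [Set.mem_ofPred_eq, smul_add] at *; rw [hx, hy]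
  zero_mem' := smul_zero _
  neg_mem' hx := by simp only [Set.mem_ofPred_eq, smul_neg] at *; rw [hx]

variable {M i}

theorem mem_component {x : M} :
    x ∈ component (B := B) M i ↔ (Pi.single i (1 : B i) : ∀ i, B i) • x = x := Iff.rfl

theorem single_smul_mem (b : B i) (x : M) :
    (Pi.single i b : ∀ i, B i) • x ∈ component (B := B) M i := by
  rw [mem_component, smul_smul, ← Pi.single_mul, one_mul]

theorem smul_eq_single_smul (r : ∀ i, B i) {x : M} (hx : x ∈ component (B := B) M i) :
    r • x = (Pi.single i (r i) : ∀ i, B i) • x := by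
  rw [← mem_component.1 hx, smul_smul, smul_smul, ← Pi.single_mul]
  congr 1
  ext j
  by_cases h : j = i
  · subst h; simp
  · simp [h]

instance : Module (B i) (component (B := B) M i) where
  smul b x := ⟨(Pi.single i b : ∀ i, B i) • x.1, single_smul_mem b x.1⟩
  one_smul x := Subtype.ext x.2
  mul_smul b c x := Subtype.ext <| by
    change (Pi.single i (b * c) : ∀ i, B i) • x.1 =
      (Pi.single i b : ∀ i, B i) • (Pi.single i c : ∀ i, B i) • x.1
    rw [smul_smul, Pi.single_mul]
  smul_zero b := Subtype.ext (smul_zero _)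
  smul_add b x y := Subtype.ext (smul_add _ _ _)
  add_smul b c x := Subtype.ext <| by
    change (Pi.single i (b + c) : ∀ i, B i) • x.1 =
      (Pi.single i b : ∀ i, B i) • x.1 + (Pi.single i c : ∀ i, B i) • x.1
    rw [Pi.single_add, add_smul]
  zero_smul x := Subtype.ext <| by
    change (Pi.single i (0 : B i) : ∀ i, B i) • x.1 = 0
    rw [Pi.single_zero, zero_smul]

end

/-- The exact functor sending a module over a product of rings to its component at `i`. -/
@[simps]
def componentFunctor (i : ι) : ModuleCat.{u} (∀ i, B i) ⥤ ModuleCat.{u} (B i) where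
  obj M := ModuleCat.of (B i) (component (B := B) M i)
  map {M N} f := ModuleCat.ofHom
    { toFun := fun x => ⟨f.hom x.1, by
        rw [mem_component, ← map_smul, mem_component.1 x.2]⟩
      map_add' := fun x y => Subtype.ext (map_add f.hom x.1 y.1)
      map_smul' := fun b x => Subtype.ext (map_smul f.hom _ x.1) }

instance (i : ι) : (componentFunctor (B := B) i).Additive where

theorem componentFunctor_exact (i : ι) :
    Limits.PreservesFiniteLimits (componentFunctor (B := B) i) ∧
      Limits.PreservesFiniteColimits (componentFunctor (B := B) i) := by
  refine ((Functor.exact_tfae (componentFunctor (B := B) i)).out 1 3).mp fun S hS => ?_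
  rw [ShortComplex.moduleCat_exact_iff] at hS ⊢
  rintro ⟨x, hx⟩ h
  obtain ⟨y, hy⟩ := hS x (congrArg Subtype.val h)
  refine ⟨⟨_, single_smul_mem (1 : B i) y⟩, Subtype.ext ?_⟩
  refine (map_smul S.f.hom _ _).trans ?_
  rw [hy]
  exact hx

instance (i : ι) : Limits.PreservesFiniteLimits (componentFunctor (B := B) i) :=
  (componentFunctor_exact i).1

instance (i : ι) : Limits.PreservesFiniteColimits (componentFunctor (B := B) i) :=
  (componentFunctor_exact i).2

end PiModule

theorem ModuleCat.restrictScalars_exact {R S : Type u} [Ring R] [Ring S] (f : R →+* S) :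
    Limits.PreservesFiniteLimits (ModuleCat.restrictScalars.{u} f) ∧
      Limits.PreservesFiniteColimits (ModuleCat.restrictScalars.{u} f) := by
  refine ((Functor.exact_tfae (ModuleCat.restrictScalars.{u} f)).out 1 3).mp fun S hS => ?_
  rw [ShortComplex.moduleCat_exact_iff] at hS ⊢
  exact hS

namespace PiModule

variable {ι : Type} [DecidableEq ι] {B : ι → Type u} [∀ i, Ring (B i)]

/-- The inclusion of the component at `i` of a module over a product of rings. -/
noncomputable def componentInclusion (i : ι) :
    componentFunctor (B := B) i ⋙ ModuleCat.restrictScalars (Pi.evalRingHom B i) ⟶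
      𝟭 (ModuleCat.{u} (∀ i, B i)) where
  app M := ModuleCat.ofHom (Y := M)
    (X := (componentFunctor (B := B) i ⋙ ModuleCat.restrictScalars (Pi.evalRingHom B i)).obj M)
    { toFun := fun x => Subtype.val (p := fun y : M => y ∈ component (B := B) M i) x
      map_add' := fun _ _ => rfl
      map_smul' := fun r x => (smul_eq_single_smul r (M := M) (i := i) (Subtype.prop x)).symm }
  naturality _ _ _ := rfl

/-- The projection of a module over a product of rings onto its component at `i`. -/
noncomputable def componentProjection (i : ι) :
    𝟭 (ModuleCat.{u} (∀ i, B i)) ⟶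
      componentFunctor (B := B) i ⋙ ModuleCat.restrictScalars (Pi.evalRingHom B i) where
  app M := ModuleCat.ofHom (X := M)
    (Y := (componentFunctor (B := B) i ⋙ ModuleCat.restrictScalars (Pi.evalRingHom B i)).obj M)
    { toFun := fun x => (⟨_, single_smul_mem (1 : B i) x⟩ : component (B := B) M i)
      map_add' := fun x y => Subtype.ext (smul_add _ x y)
      map_smul' := fun r x => Subtype.ext <| by
        change (Pi.single i (1 : B i) : ∀ i, B i) • r • x =
          (Pi.single i (r i) : ∀ i, B i) • (Pi.single i (1 : B i) : ∀ i, B i) • x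
        rw [smul_smul, smul_smul, ← Pi.single_mul]
        congr 1
        ext j
        by_cases h : j = i
        · subst h; simp
        · simp [h] }
  naturality M N f := by
    ext x
    exact Subtype.ext (map_smul f.hom _ x).symm

theorem componentInclusion_projection (i : ι) (M : ModuleCat.{u} (∀ i, B i)) :
    (componentInclusion (B := B) i).app M ≫ (componentProjection i).app M = 𝟙 _ := by
  ext x
  exact Subtype.ext (Subtype.prop x)

theorem sum_single_one_smul [Fintype ι] {M : Type u} [AddCommGroup M] [Module (∀ i, B i) M]
    (x : M) : ∑ i, (Pi.single i (1 : B i) : ∀ i, B i) • x = x := by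
  rw [← Finset.sum_smul]
  convert one_smul (∀ i, B i) x
  exact Finset.univ_sum_single (1 : ∀ i, B i)

theorem sum_componentProjection_inclusion [Fintype ι] (M : ModuleCat.{u} (∀ i, B i)) :
    ∑ i, (componentProjection (B := B) i).app M ≫ (componentInclusion i).app M = 𝟙 _ := by
  ext x
  rw [ModuleCat.hom_sum, LinearMap.sum_apply]
  exact sum_single_one_smul (B := B) (M := M) x

/-- A module over a factor of a product of rings is the corresponding component of its restriction
to the product. -/
noncomputable def componentRestrictScalarsIso (i : ι) :
    ModuleCat.restrictScalars (Pi.evalRingHom B i) ⋙ componentFunctor i ≅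
      𝟭 (ModuleCat.{u} (B i)) :=
  NatIso.ofComponents (fun N => LinearEquiv.toModuleIso
    (X₁ := component (B := B) ((ModuleCat.restrictScalars (Pi.evalRingHom B i)).obj N) i) (X₂ := N)
    { toFun := fun x => (x.1 : N)
      invFun := fun x => ⟨x, by
        change (Pi.single i (1 : B i) : ∀ i, B i) i • x = x
        rw [Pi.single_eq_same, one_smul]⟩
      left_inv := fun _ => rfl
      right_inv := fun _ => rfl
      map_add' := fun _ _ => rfl
      map_smul' := fun r x => by
        change (Pi.single i r : ∀ i, B i) i • (show N from x.1) = r • (show N from x.1)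
        rw [Pi.single_eq_same] })
    fun _ => rfl

instance (i : ι) :
    Limits.PreservesFiniteLimits (ModuleCat.restrictScalars.{u} (Pi.evalRingHom B i)) :=
  (ModuleCat.restrictScalars_exact _).1

instance (i : ι) :
    Limits.PreservesFiniteColimits (ModuleCat.restrictScalars.{u} (Pi.evalRingHom B i)) :=
  (ModuleCat.restrictScalars_exact _).2

theorem isZero_component_restrictScalars {i j : ι} (hij : i ≠ j) (N : ModuleCat.{u} (B i)) :
    Limits.IsZero ((componentFunctor (B := B) j).obj
      ((ModuleCat.restrictScalars (Pi.evalRingHom B i)).obj N)) := by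
  refine @ModuleCat.isZero_of_subsingleton _ _ _ ⟨fun x y => Subtype.ext ?_⟩
  have h : ∀ z : component (B := B) ((ModuleCat.restrictScalars (Pi.evalRingHom B i)).obj N) j,
      z.1 = 0 := fun z => by
    refine z.2.symm.trans ?_
    change (Pi.single j (1 : B j) : ∀ i, B i) i • (show N from z.1) = 0
    rw [Pi.single_eq_of_ne hij, zero_smul]
  exact (h x).trans (h y).symm

theorem isFG_componentFunctor_obj (i : ι) (M : ModuleCat.{u} (∀ i, B i))
    (hM : ModuleCat.isFG _ M) : ModuleCat.isFG _ ((componentFunctor (B := B) i).obj M) := by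
  have : Module.Finite (∀ i, B i) M := hM
  let f : M →ₛₗ[Pi.evalRingHom B i] component (B := B) M i :=
    { toFun := fun x => ⟨_, single_smul_mem (1 : B i) x⟩
      map_add' := fun x y => Subtype.ext (smul_add _ x y)
      map_smul' := fun r x => ((componentProjection (B := B) i).app M).hom.map_smul r x }
  have : RingHomSurjective (Pi.evalRingHom B i) := ⟨fun b => ⟨Pi.single i b, Pi.single_eq_same i b⟩⟩
  exact Module.Finite.of_surjective f fun x => ⟨x.1, Subtype.ext x.2⟩

theorem isFG_restrictScalars_obj (i : ι) (N : ModuleCat.{u} (B i)) (hN : ModuleCat.isFG _ N) :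
    ModuleCat.isFG _ ((ModuleCat.restrictScalars (Pi.evalRingHom B i)).obj N) := by
  -- a generating set over the factor also generates over the product
  obtain ⟨s, hs⟩ := hN
  let N' := (ModuleCat.restrictScalars (Pi.evalRingHom B i)).obj N
  refine ⟨(show Finset N' from s), eq_top_iff.2 fun x _ => ?_⟩
  have hx : ∀ y : N, y ∈ Submodule.span (B i) (s : Set N) →
      (show N' from y) ∈ Submodule.span (∀ i, B i) (show Finset N' from s) := fun y hy => by
    induction hy using Submodule.span_induction with
    | mem y hy => exact Submodule.subset_span hy
    | zero => exact Submodule.zero_mem _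
    | add y z _ _ hy hz => exact Submodule.add_mem _ hy hz
    | smul b y _ hy =>
      have h : (Pi.single i b : ∀ i, B i) • (show N' from y) = (show N' from b • y) :=
        congrArg (· • y) (Pi.single_eq_same i b)
      exact h ▸ Submodule.smul_mem _ (Pi.single i b : ∀ i, B i) hy
  exact hx x (hs ▸ Submodule.mem_top)

/-- The lattice of thick subcategories of the bounded derived category of a finite product of left
Noetherian rings is the product of those of the factors. -/
noncomputable def thickOrderIso [Fintype ι] [∀ i, IsNoetherianRing (B i)]
    [IsNoetherianRing (∀ i, B i)] :
    ThickSubcategory (BoundedDerivedCategory (∀ i, B i)) ≃o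
      ∀ i, ThickSubcategory (BoundedDerivedCategory (B i)) :=
  DerivedCategory.thickBoundedOrderIsoPi (C' := fun i => FGModuleCat.{u} (B i))
    (fun i => FGModuleCat.liftFunctor (ModuleCat.restrictScalars (Pi.evalRingHom B i))
      (isFG_restrictScalars_obj i))
    (fun i => FGModuleCat.liftFunctor (componentFunctor i) (isFG_componentFunctor_obj i))
    (fun i => NatIso.ofComponents
      (fun N => (ModuleCat.isFG _).isoMk ((componentRestrictScalarsIso i).app N.obj))
      fun f => ObjectProperty.hom_ext _ ((componentRestrictScalarsIso i).hom.naturality f.hom))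
    (fun _ _ hij N => Limits.IsZero.of_full_of_faithful_of_isZero (ModuleCat.isFG _).ι _
      (isZero_component_restrictScalars hij N.obj))
    (fun i =>
      { app := fun M => ObjectProperty.homMk ((componentInclusion i).app M.obj)
        naturality := fun _ _ f =>
          ObjectProperty.hom_ext _ ((componentInclusion i).naturality f.hom) })
    (fun i =>
      { app := fun M => ObjectProperty.homMk ((componentProjection i).app M.obj)
        naturality := fun _ _ f =>
          ObjectProperty.hom_ext _ ((componentProjection i).naturality f.hom) })
    (fun i M => ObjectProperty.hom_ext _ (componentInclusion_projection i M.obj))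
    (fun M => ObjectProperty.hom_ext _ (((ModuleCat.isFG _).ι.map_sum _ _).trans
      (sum_componentProjection_inclusion M.obj)))

/-- The product of a family of modules, as a module over the product of the rings. -/
def prodFunctor : (∀ i, ModuleCat.{u} (B i)) ⥤ ModuleCat.{u} (∀ i, B i) where
  obj N := ModuleCat.of (∀ i, B i) (∀ i, N i)
  map {N N'} f := ModuleCat.ofHom
    { toFun := fun x i => (f i).hom (x i)
      map_add' := fun x y => funext fun i => map_add (f i).hom _ _
      map_smul' := fun r x => funext fun i => map_smul (f i).hom _ _ }

/-- The component at `i` of a product of modules is the factor at `i`. -/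
def prodComponentEquiv (N : ι → Type u) [∀ i, AddCommGroup (N i)] [∀ i, Module (B i) (N i)]
    (i : ι) : component (B := B) (∀ i, N i) i ≃ₗ[B i] N i :=
    { toFun := fun x => x.1 i
      invFun := fun x => ⟨Pi.single i x, by
        rw [mem_component]
        ext j
        by_cases h : j = i
        · subst h; simp
        · simp [h]⟩
      left_inv := fun x => Subtype.ext <| by
        refine Eq.trans ?_ x.2
        ext j
        by_cases h : j = i
        · subst h; simp
        · simp [h]
      right_inv := fun x => Pi.single_eq_same i x
      map_add' := fun _ _ => rfl
      map_smul' := fun r x => by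
        change (Pi.single i r : ∀ i, B i) i • x.1 i = r • x.1 i
        rw [Pi.single_eq_same] }

/-- A module over a finite product of rings is the product of its components. -/
def prodOfComponentsEquiv [Fintype ι] (M : Type u) [AddCommGroup M] [Module (∀ i, B i) M] :
    M ≃ₗ[∀ i, B i] (∀ i, component (B := B) M i) :=
    { toFun := fun x i => ⟨_, single_smul_mem (1 : B i) x⟩
      invFun := fun y => ∑ i, (y i).1
      left_inv := fun x => sum_single_one_smul x
      right_inv := fun y => funext fun i => Subtype.ext <| by
        change (Pi.single i (1 : B i) : ∀ i, B i) • ∑ j, (y j).1 = (y i).1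
        rw [Finset.smul_sum, Finset.sum_eq_single i _ (by simp)]
        · exact (y i).2
        · intro j _ hj
          rw [← (y j).2, smul_smul, smul_eq_single_smul _ (y j).2]
          simp [hj]
      map_add' := fun x y => funext fun i => Subtype.ext (smul_add _ x y)
      map_smul' := fun r x => funext fun i =>
        ((componentProjection (B := B) i).app (ModuleCat.of _ M)).hom.map_smul r x }

/-- A module over a finite product of rings amounts to a family of modules over the factors. -/
def equivalencePi [Fintype ι] :
    ModuleCat.{u} (∀ i, B i) ≌ ∀ i, ModuleCat.{u} (B i) :=
  CategoryTheory.Equivalence.mk (Functor.pi' componentFunctor) prodFunctor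
    (NatIso.ofComponents
      (fun M => (prodOfComponentsEquiv M).toModuleIso (X₁ := M))
      fun {M N} f => by
        ext x
        exact funext fun i => Subtype.ext
          (map_smul f.hom (Pi.single i (1 : B i) : ∀ i, B i) x).symm)
    (NatIso.ofComponents (fun N => Pi.isoMk fun i => (prodComponentEquiv (fun i => N i) i).toModuleIso)
      fun _ => rfl)

end PiModule

/-! ### Morita equivalence of finite products -/

open PiModule

open scoped ModuleCat.Algebra

theorem IsMoritaEquivalent.pi {k : Type v} [Field k] {ι : Type} [Finite ι] {A B : ι → Type u}
    [∀ i, Ring (A i)] [∀ i, Ring (B i)] [∀ i, Algebra k (A i)] [∀ i, Algebra k (B i)]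
    (h : ∀ i, IsMoritaEquivalent k (A i) (B i)) : IsMoritaEquivalent k (∀ i, A i) (∀ i, B i) := by
  classical
  have := Fintype.ofFinite ι
  let E := fun i => (h i).cond.some
  refine ⟨⟨⟨equivalencePi.trans ((CategoryTheory.Equivalence.pi fun i => (E i).eqv).trans
    equivalencePi.symm), ⟨fun {M N} f r => ?_⟩⟩⟩⟩
  have h : ∀ i, (componentFunctor i).map (r • f) = r • (componentFunctor i).map f := fun i => by
    ext x
    exact Subtype.ext (smul_eq_single_smul (algebraMap k (∀ i, A i) r)
      (((componentFunctor i).map f).hom x).2)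
  ext x
  refine funext fun i => ?_
  change ((E i).eqv.functor.map ((componentFunctor i).map (r • f))).hom _ = _
  rw [h, Functor.map_smul]
  rfl

/-! ### Generation and orthogonality in bounded derived categories -/

namespace DerivedCategory

open Limits Pretriangulated

universe w v₁ u₁

variable {C : Type u₁} [Category.{v₁} C] [Abelian C] [HasDerivedCategory.{w} C]

/-- An iso-closed triangulated subcategory of the derived category containing the objects of the
abelian category contains all bounded complexes, by induction on their amplitude. -/
theorem prop_of_prop_singleFunctor (R : ObjectProperty (DerivedCategory C)) [R.IsTriangulated]
    [R.IsClosedUnderIsomorphisms] (h : ∀ M : C, R ((singleFunctor C 0).obj M))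
    {X : DerivedCategory C} (hX : TStructure.t.bounded X) : R X := by
  suffices ∀ (n : ℕ) (X : DerivedCategory C) (a : ℤ), X.IsGE a → X.IsLE (a + n) → R X by
    obtain ⟨⟨a, ha⟩, ⟨b, hb⟩⟩ := hX
    exact this (b - a).toNat X a ha (TStructure.t.isLE_of_le X b _ (by lia))
  intro n
  induction n with
  | zero =>
    intro X a _ _
    have : X.IsLE a := by simpa using ‹X.IsLE (a + (0 : ℕ))›
    obtain ⟨Y, ⟨e⟩⟩ := exists_iso_singleFunctor_obj_of_isGE_of_isLE X a
    have e' := ((singleFunctors C).shiftIso (-a) a 0 (by simp)).app Y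
    exact R.prop_of_iso e.symm (R.prop_of_iso e' (R.le_shift (-a) _ (h Y)))
  | succ n ih =>
    intro X a _ _
    -- truncation splits off the top cohomology
    obtain ⟨Y, Z, hY, hZ, f, g, δ, hT⟩ := TStructure.t.exists_triangle X (a + n) (a + n + 1) rfl
    have hY' : Y.IsLE (a + n) := ⟨hY⟩
    have hZ' : Z.IsGE (a + n + 1) := ⟨hZ⟩
    refine R.ext_of_isTriangulatedClosed₂ _ hT (ih Y a ?_ hY') (ih Z (a + n + 1) hZ' ?_)
    · have : X.IsGE a := inferInstance
      have := TStructure.t.isGE_shift Z (a + n + 1) (-1) (a + n + 2)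
      have := TStructure.t.isGE_of_ge (Z⟦(-1 : ℤ)⟧) a (a + n + 2)
      exact TStructure.t.isGE₂ _ (inv_rot_of_distTriang _ hT) a (by simpa) (by simpa)
    · have := TStructure.t.isLE_shift Y (a + n) 1 (a + n - 1)
      have := TStructure.t.isLE_of_le (Y⟦(1 : ℤ)⟧) (a + n - 1) (a + n + 1)
      have : X.IsLE (a + n + 1) := by simpa [add_assoc] using ‹X.IsLE (a + (n + 1 : ℕ))›
      have : Z.IsLE (a + n + 1) := TStructure.t.isLE₂ _ (rot_of_distTriang _ hT) (a + n + 1)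
        (by simpa) (by simpa)
      exact TStructure.t.isLE_of_le Z (a + n + 1) _

/-- A projective object is orthogonal to all shifts of an object as soon as it is in degree zero. -/
theorem singleFunctor_hom_shift_eq_zero {P S : C} [Projective P] (h : ∀ f : P ⟶ S, f = 0) (n : ℤ)
    (f : (singleFunctor C 0).obj P ⟶ ((singleFunctor C 0).obj S)⟦n⟧) : f = 0 := by
  obtain hn | rfl | hn := lt_trichotomy n 0
  · have := TStructure.t.isGE_shift ((singleFunctor C 0).obj S) 0 n (-n)
    exact TStructure.t.zero f 0 (-n)
  · rw [← cancel_mono ((shiftFunctorZero _ ℤ).hom.app _), zero_comp]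
    obtain ⟨g, hg⟩ := (singleFunctor C 0).map_surjective
      (f ≫ (shiftFunctorZero _ ℤ).hom.app _)
    rw [← hg, h g, Functor.map_zero]
  · have : (((singleFunctor C 0).obj S)⟦n⟧).IsLE (-n) :=
      TStructure.t.isLE_shift ((singleFunctor C 0).obj S) 0 n (-n)
    obtain ⟨L, _, ⟨e⟩⟩ := exists_iso_Q_obj_of_isLE (((singleFunctor C 0).obj S)⟦n⟧) (-n)
    rw [← cancel_mono e.hom, zero_comp]
    exact from_singleFunctor_obj_eq_zero_of_projective (i := 0) (L := L) (f ≫ e.hom) (-n) (by lia)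

namespace Bounded

/-- An object of an abelian category, as an object of its bounded derived category. -/
noncomputable def single : C ⥤ Bounded C :=
  TStructure.t.bounded.lift (singleFunctor C 0)
    fun _ => ⟨⟨0, inferInstance⟩, ⟨0, inferInstance⟩⟩

theorem single_hom_shift_eq_zero {P S : C} [Projective P] (h : ∀ f : P ⟶ S, f = 0) (n : ℤ)
    (f : single.obj P ⟶ (single.obj S)⟦n⟧) : f = 0 := by
  apply ι.map_injective
  rw [← cancel_mono ((ι.commShiftIso n).hom.app _), Functor.map_zero, zero_comp]
  exact singleFunctor_hom_shift_eq_zero h n _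

theorem eq_zero_of_single_hom_eq_zero {P S : C} (h : ∀ f : single.obj P ⟶ single.obj S, f = 0)
    (f : P ⟶ S) : f = 0 := by
  have := congrArg ι.map (h (single.map f))
  apply (singleFunctor C 0).map_injective
  rw [Functor.map_zero]
  exact this

theorem eq_top_of_prop_single (P : ThickSubcategory (Bounded C))
    (h : ∀ M : C, P.prop (single.obj M)) : P = ⊤ := by
  refine top_unique fun X _ => ?_
  have : (P.prop.map ι) X.obj := prop_of_prop_singleFunctor (P.prop.map ι)
    (fun M => P.prop.prop_map_obj ι (h M)) X.property
  obtain ⟨Y, hY, ⟨e⟩⟩ := this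
  exact P.prop.prop_of_iso (ι.preimageIso e) hY

theorem prop_single_of_shortExact (P : ThickSubcategory (Bounded C)) {S : ShortComplex C}
    (hS : S.ShortExact) (h₁ : P.prop (single.obj S.X₁)) (h₃ : P.prop (single.obj S.X₃)) :
    P.prop (single.obj S.X₂) := by
  have : (P.prop.map ι) ((singleFunctor C 0).obj S.X₂) :=
    (P.prop.map ι).ext_of_isTriangulatedClosed₂ _ hS.singleTriangle_distinguished
      (P.prop.prop_map_obj ι h₁) (P.prop.prop_map_obj ι h₃)
  obtain ⟨Y, hY, ⟨e⟩⟩ := this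
  exact P.prop.prop_of_iso (ι.preimageIso e) hY

end Bounded

end DerivedCategory

namespace ThickSubcategory

variable {T : Type*} [Category* T] [Limits.HasZeroObject T] [HasShift T ℤ]
  [Preadditive T] [∀ n : ℤ, (shiftFunctor T n).Additive] [Pretriangulated T]

instance (Q : ObjectProperty T) : Q.rightOrthogonal.IsStableUnderRetracts where
  of_retract r h X f hX := by
    have := h (f ≫ r.i) hX
    rw [← Category.comp_id f, ← r.retract, ← Category.assoc, this, Limits.zero_comp]

instance (Q : ObjectProperty T) : Q.leftOrthogonal.IsStableUnderRetracts where
  of_retract r h X f hX := by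
    have := h (r.r ≫ f) hX
    rw [← Category.id_comp f, ← r.retract, Category.assoc, this, Limits.comp_zero]

/-- The thick subcategory of the objects right orthogonal to all shifts of objects in a class. -/
def rightOrthogonal (Q : ObjectProperty T) : ThickSubcategory T where
  prop := (Q.shiftClosure ℤ).rightOrthogonal
  isTriangulated := inferInstance
  isStableUnderRetracts := inferInstance

/-- The thick subcategory of the objects left orthogonal to all shifts of objects in a class. -/
def leftOrthogonal (Q : ObjectProperty T) : ThickSubcategory T where
  prop := (Q.shiftClosure ℤ).leftOrthogonal
  isTriangulated := inferInstance
  isStableUnderRetracts := inferInstance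

theorem leftOrthogonal_prop_iff (Q : ObjectProperty T) (X : T) :
    (leftOrthogonal Q).prop X ↔ ∀ (Y : T), Q Y → ∀ (n : ℤ) (f : X ⟶ Y⟦n⟧), f = 0 := by
  refine ⟨fun h Y hY n f => h f ⟨Y, n, Iso.refl _, hY⟩, ?_⟩
  rintro h Z f ⟨Y, n, e, hY⟩
  rw [← cancel_mono e.hom, Limits.zero_comp]
  exact h Y hY n _

theorem rightOrthogonal_prop_of_forall {Q : ObjectProperty T} {Y : T}
    (h : ∀ (X : T), Q X → ∀ (n : ℤ) (f : X ⟶ Y⟦n⟧), f = 0) : (rightOrthogonal Q).prop Y := by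
  rintro Z f ⟨X, n, e, hX⟩
  rw [← cancel_epi e.inv, Limits.comp_zero]
  obtain ⟨g, hg⟩ := ((shiftEquiv T n).toAdjunction.homEquiv X Y).symm.surjective (e.inv ≫ f)
  refine hg.symm.trans ?_
  have hg₀ : g = (0 : X ⟶ (shiftEquiv T n).inverse.obj Y) := h X hX (-n) g
  rw [hg₀, Adjunction.homEquiv_counit, Functor.map_zero, Limits.zero_comp]
  rfl

theorem eq_zero_of_rightOrthogonal_prop {Q : ObjectProperty T} {X Y : T}
    (hY : (rightOrthogonal Q).prop Y) (hX : Q X) (f : X ⟶ Y) : f = 0 :=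
  hY f ⟨X, 0, (shiftFunctorZero T ℤ).symm.app X, hX⟩

/-- The thick subcategory generated by a class of objects. -/
def closure (Q : ObjectProperty T) : ThickSubcategory T := sInf {P | Q ≤ P.prop}

theorem le_closure (Q : ObjectProperty T) : Q ≤ (closure Q).prop :=
  fun _ hX _ hP => hP _ hX

theorem closure_le {Q : ObjectProperty T} {P : ThickSubcategory T} (h : Q ≤ P.prop) :
    closure Q ≤ P := sInf_le h

/-- A class of objects and a left orthogonal thick subcategory meet in zero objects only. -/
theorem leftOrthogonal_inf_closure (Q : ObjectProperty T) :
    leftOrthogonal Q ⊓ closure Q = ⊥ := by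
  refine bot_unique fun X hX R _ => ?_
  rw [inf_prop] at hX
  have hle : closure Q ≤ rightOrthogonal (ObjectProperty.singleton X) :=
    closure_le fun Y hY => rightOrthogonal_prop_of_forall fun X' hX' n f => by
      obtain rfl := (ObjectProperty.singleton_iff _ _).1 hX'
      exact (leftOrthogonal_prop_iff Q _).1 hX.1 Y hY n f
  have hzero : Limits.IsZero X := (Limits.IsZero.iff_id_eq_zero X).2
    (eq_zero_of_rightOrthogonal_prop (hle X hX.2) (by simp) _)
  have := R.isTriangulated
  have := R.isStableUnderRetracts
  exact R.prop.prop_of_isZero hzero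

end ThickSubcategory

/-! ### Orthogonality of projective objects -/

namespace DerivedCategory.Bounded

universe w v₁ u₁

variable {C : Type u₁} [Category.{v₁} C] [Abelian C] [HasDerivedCategory.{w} C]

/-- The thick subcategories `y` and `z` generated by `S` and by `Q` have join `⊤`, and the left
orthogonal `x` of `Q` meets `z` trivially. Distributivity forces `x ≤ y`, so that `P`, which lies
in `x`, is built from `S`, to which `P'` is orthogonal. -/
theorem hom_eq_zero_of_isDistributiveLattice
    (hD : IsDistributiveLattice (ThickSubcategory (Bounded C))) (Q : ObjectProperty C) {S P P' : C}
    [Projective P] [Projective P']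
    (hgen : ∀ R : ThickSubcategory (Bounded C), R.prop (single.obj S) →
      (∀ S', Q S' → R.prop (single.obj S')) → R = ⊤)
    (hP : ∀ S', Q S' → ∀ f : P ⟶ S', f = 0) (hP' : ∀ f : P' ⟶ S, f = 0) (f : P' ⟶ P) :
    f = 0 := by
  set y := ThickSubcategory.closure (ObjectProperty.singleton (single.obj S))
  set z := ThickSubcategory.closure (Q.map single)
  set x := ThickSubcategory.leftOrthogonal (Q.map single)
  have hyz : y ⊔ z = ⊤ := hgen _
    ((le_sup_left : y ≤ y ⊔ z) _ (ThickSubcategory.le_closure _ _ (by simp)))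
    fun S' hS' => (le_sup_right : z ≤ y ⊔ z) _
      (ThickSubcategory.le_closure _ _ (Q.prop_map_obj single hS'))
  have hxy : x ≤ y := by
    have := hD x y z
    rw [hyz, inf_top_eq, ThickSubcategory.leftOrthogonal_inf_closure, sup_bot_eq] at this
    exact inf_eq_left.1 this.symm
  have hPx : x.prop (single.obj P) := by
    rw [ThickSubcategory.leftOrthogonal_prop_iff]
    rintro Y ⟨S', hS', ⟨e⟩⟩ n f
    rw [← cancel_mono (e.inv⟦n⟧'), Limits.zero_comp]
    exact single_hom_shift_eq_zero (hP S' hS') n _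
  have hy : y ≤ ThickSubcategory.rightOrthogonal (ObjectProperty.singleton (single.obj P')) := by
    refine ThickSubcategory.closure_le fun Y hY =>
      ThickSubcategory.rightOrthogonal_prop_of_forall fun X hX n f => ?_
    obtain rfl := (ObjectProperty.singleton_iff _ _).1 hX
    obtain rfl := (ObjectProperty.singleton_iff _ _).1 hY
    exact single_hom_shift_eq_zero hP' n f
  exact eq_zero_of_single_hom_eq_zero (fun f => ThickSubcategory.eq_zero_of_rightOrthogonal_prop
    (hy _ (hxy _ hPx)) (by simp) f) f

instance : (single (C := C)).Additive where
  map_add := ι.map_injective (singleFunctor C 0).map_add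

end DerivedCategory.Bounded

namespace FGModuleCat

variable {A : Type u} [Ring A] [IsNoetherianRing A]

theorem projective_of_module_projective (P : FGModuleCat.{u} A) [Module.Projective A P] :
    Projective P where
  factors {E X} f e _ := by
    have : Function.Surjective e.hom.hom := by
      rw [← ModuleCat.epi_iff_surjective]
      exact inferInstanceAs (Epi ((forget₂ (FGModuleCat A) (ModuleCat A)).map e))
    obtain ⟨g, hg⟩ := Module.projective_lifting_property e.hom.hom f.hom.hom this
    exact ⟨FGModuleCat.ofHom g, by ext x; exact LinearMap.congr_fun hg x⟩

end FGModuleCat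

open DerivedCategory in
/-- A thick subcategory of the bounded derived category that contains the simple modules contains
all modules of finite length. -/
theorem prop_single_of_isFiniteLength {A : Type u} [Ring A] [IsNoetherianRing A]
    (R : ThickSubcategory (BoundedDerivedCategory A))
    (h : ∀ (S : Type u) [AddCommGroup S] [Module A S] [Module.Finite A S] [IsSimpleModule A S],
      R.prop (Bounded.single.obj (FGModuleCat.of A S)))
    (M : Type u) [AddCommGroup M] [Module A M] (hM : IsFiniteLength A M) [Module.Finite A M] :
    R.prop (Bounded.single.obj (FGModuleCat.of A M)) := by
  rename_i hfin
  revert hfin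
  induction hM with
  | of_subsingleton =>
    intro hfin
    have := R.isTriangulated
    have := R.isStableUnderRetracts
    refine R.prop.prop_of_isZero (Bounded.single.map_isZero ?_)
    rw [Limits.IsZero.iff_id_eq_zero]
    ext x
    exact Subsingleton.elim _ _
  | @of_simple_quotient M _ _ N _ hN ih =>
    intro hfin
    have : IsNoetherian A M := isNoetherian_of_isNoetherianRing_of_finite A M
    have : Module.Finite A N := Module.IsNoetherian.finite A N
    let T : ShortComplex (FGModuleCat A) :=
      ShortComplex.mk (X₁ := FGModuleCat.of A N) (X₂ := FGModuleCat.of A M)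
        (X₃ := FGModuleCat.of A (M ⧸ N)) (FGModuleCat.ofHom N.subtype) (FGModuleCat.ofHom N.mkQ)
        (by ext x; exact (Submodule.Quotient.mk_eq_zero N).2 x.2)
    have hT : T.ShortExact :=
      { exact := by
          rw [← ShortComplex.exact_map_iff_of_faithful T (forget₂ (FGModuleCat.{u} A) (ModuleCat.{u} A)),
            ShortComplex.moduleCat_exact_iff]
          intro x hx
          exact ⟨⟨x, (Submodule.Quotient.mk_eq_zero N).1 hx⟩, rfl⟩
        mono_f := ConcreteCategory.mono_of_injective _ fun x y h => Subtype.ext h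
        epi_g := ConcreteCategory.epi_of_surjective _ fun x => N.mkQ_surjective x }
    exact Bounded.prop_single_of_shortExact R hT ih (h (M ⧸ N))

open DerivedCategory in
/-- When `Thick(D^b(A))` is distributive, a finitely generated projective module `P` whose simple
quotients are all isomorphic to `S` receives no nonzero morphism from a finitely generated
projective module `P'` orthogonal to `S`. -/
theorem linearMap_eq_zero_of_isDistributiveLattice {A : Type u} [Ring A] [IsArtinianRing A]
    [IsNoetherianRing A]
    (hD : IsDistributiveLattice (ThickSubcategory (BoundedDerivedCategory A)))
    {S P P' : Type u} [AddCommGroup S] [Module A S] [IsSimpleModule A S]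
    [AddCommGroup P] [Module A P] [Module.Finite A P] [Module.Projective A P]
    [AddCommGroup P'] [Module A P'] [Module.Finite A P'] [Module.Projective A P']
    (hP : ∀ (S' : Type u) [AddCommGroup S'] [Module A S'] [IsSimpleModule A S'],
      IsEmpty (S' ≃ₗ[A] S) → ∀ f : P →ₗ[A] S', f = 0)
    (hP' : ∀ f : P' →ₗ[A] S, f = 0) (f : P' →ₗ[A] P) : f = 0 := by
  have := FGModuleCat.projective_of_module_projective (FGModuleCat.of A P)
  have := FGModuleCat.projective_of_module_projective (FGModuleCat.of A P')
  let Q : ObjectProperty (FGModuleCat.{u} A) :=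
    fun S' => IsSimpleModule A S' ∧ IsEmpty (S' ≃ₗ[A] S)
  have h0 := Bounded.hom_eq_zero_of_isDistributiveLattice hD Q (S := FGModuleCat.of A S)
    (P := FGModuleCat.of A P) (P' := FGModuleCat.of A P') ?_ ?_ ?_ (FGModuleCat.ofHom f)
  · exact congrArg (fun g => g.hom.hom) h0
  · refine fun R hS hQ => Bounded.eq_top_of_prop_single R fun M =>
      prop_single_of_isFiniteLength R (fun S' _ _ _ _ => ?_) M
        (isFiniteLength_iff_isNoetherian_isArtinian.2
          ⟨isNoetherian_of_isNoetherianRing_of_finite A M,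
            isArtinian_of_fg_of_artinian' ⟩)
    by_cases h : IsEmpty (S' ≃ₗ[A] S)
    · exact hQ (FGModuleCat.of A S') ⟨‹_›, h⟩
    · obtain ⟨e⟩ := not_isEmpty_iff.1 h
      have := R.isTriangulated
      have := R.isStableUnderRetracts
      exact R.prop.prop_of_iso (Bounded.single.mapIso e.symm.toFGModuleCatIso) hS
  · rintro S' ⟨_, h⟩ f
    ext x
    exact LinearMap.congr_fun (hP S' h f.hom.hom) x
  · intro f
    ext x
    exact LinearMap.congr_fun (hP' f.hom.hom) x

/-! ### Indecomposable modules -/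

section Indecomposable

variable {R : Type*} [Ring R] {M N S S' : Type*} [AddCommGroup M] [Module R M]
  [AddCommGroup N] [Module R N] [AddCommGroup S] [Module R S] [AddCommGroup S'] [Module R S']

variable (R M) in
/-- A nonzero module all of whose direct sum decompositions are trivial. -/
structure Module.IsIndecomposable : Prop where
  nontrivial : Nontrivial M
  eq_bot_or_eq_bot : ∀ p q : Submodule R M, IsCompl p q → p = ⊥ ∨ q = ⊥

variable (R M) in
/-- An Artinian module is a finite direct sum of indecomposable submodules. -/
theorem exists_linearEquiv_pi_isIndecomposable [IsArtinian R M] :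
    ∃ (ι : Type) (_ : Fintype ι) (P : ι → Submodule R M),
      (∀ i, Module.IsIndecomposable R (P i)) ∧ Nonempty (M ≃ₗ[R] ∀ i, P i) := by
  suffices ∀ N : Submodule R M, ∃ (ι : Type) (_ : Fintype ι) (P : ι → Submodule R M),
      (∀ i, Module.IsIndecomposable R (P i)) ∧ Nonempty (N ≃ₗ[R] ∀ i, P i) by
    obtain ⟨ι, _, P, hP, ⟨e⟩⟩ := this ⊤
    exact ⟨ι, ‹_›, P, hP, ⟨Submodule.topEquiv.symm.trans e⟩⟩
  intro N
  induction N using WellFoundedLT.induction with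
  | ind N ih =>
    by_cases hN : Subsingleton N
    · exact ⟨Empty, inferInstance, Empty.elim, fun i => i.elim, ⟨LinearEquiv.ofSubsingleton _ _⟩⟩
    have hN : Nontrivial N := not_subsingleton_iff_nontrivial.1 hN
    by_cases h : ∀ p q : Submodule R N, IsCompl p q → p = ⊥ ∨ q = ⊥
    · exact ⟨Unit, inferInstance, fun _ => N, fun _ => ⟨hN, h⟩,
        ⟨(LinearEquiv.funUnique Unit R N).symm⟩⟩
    push Not at h
    obtain ⟨p, q, hpq, hp, hq⟩ := h
    have key : ∀ p q : Submodule R N, IsCompl p q → q ≠ ⊥ → ∃ (ι : Type) (_ : Fintype ι)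
        (P : ι → Submodule R M),
        (∀ i, Module.IsIndecomposable R (P i)) ∧ Nonempty (p ≃ₗ[R] ∀ i, P i) := by
      intro p q hpq hq
      obtain ⟨ι, _, P, hP, ⟨e⟩⟩ := ih (p.map N.subtype) (by
        refine lt_of_le_of_ne (Submodule.map_subtype_le N p) fun h => hq ?_
        have : p = ⊤ := Submodule.map_injective_of_injective N.subtype_injective (by simpa using h)
        rw [this] at hpq
        exact eq_bot_of_top_isCompl hpq)
      exact ⟨ι, ‹_›, P, hP, ⟨(Submodule.equivMapOfInjective _ N.subtype_injective p).trans e⟩⟩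
    obtain ⟨ι₁, _, P₁, hP₁, ⟨e₁⟩⟩ := key p q hpq hq
    obtain ⟨ι₂, _, P₂, hP₂, ⟨e₂⟩⟩ := key q p hpq.symm hp
    exact ⟨ι₁ ⊕ ι₂, inferInstance, Sum.elim P₁ P₂, Sum.rec hP₁ hP₂,
      ⟨(Submodule.prodEquivOfIsCompl p q hpq).symm.trans ((e₁.prodCongr e₂).trans
        (LinearEquiv.sumPiEquivProdPi R ι₁ ι₂ fun i => (Sum.elim P₁ P₂ i : Submodule R M)).symm)⟩⟩

/-- By Fitting's lemma, an endomorphism of an indecomposable module of finite length is bijective or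
nilpotent. -/
theorem Module.IsIndecomposable.isLocalRing_end [IsArtinian R M] [IsNoetherian R M]
    (h : Module.IsIndecomposable R M) : IsLocalRing (Module.End R M) := by
  have := h.nontrivial
  refine { isUnit_or_isUnit_of_add_one := fun {f g} hfg => ?_ }
  obtain ⟨n, hn, hc⟩ := ((Filter.eventually_ge_atTop 1).and
    (LinearMap.eventually_isCompl_ker_pow_range_pow f)).exists
  obtain hk | hr := h.eq_bot_or_eq_bot _ _ hc
  · left
    rw [← isUnit_pow_iff (Nat.one_le_iff_ne_zero.1 hn), Module.End.isUnit_iff]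
    refine ⟨LinearMap.ker_eq_bot.1 hk, LinearMap.range_eq_top.1 ?_⟩
    rw [hk] at hc
    exact eq_top_of_bot_isCompl hc
  · right
    obtain rfl : g = 1 - f := by rw [← hfg]; abel
    exact IsNilpotent.isUnit_one_sub ⟨n, LinearMap.range_eq_bot.1 hr⟩

/-- The top of a projective module with local endomorphism ring is simple: two nonzero morphisms to
simple modules have the same kernel. -/
theorem ker_eq_ker_of_isLocalRing_end [Module.Projective R M] [IsLocalRing (Module.End R M)]
    [IsSimpleModule R S] [IsSimpleModule R S'] {f : M →ₗ[R] S} {g : M →ₗ[R] S'}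
    (hf : f ≠ 0) (hg : g ≠ 0) : LinearMap.ker f = LinearMap.ker g := by
  by_contra hne
  have hsup : LinearMap.ker f ⊔ LinearMap.ker g = ⊤ :=
    (LinearMap.isCoatom_ker_of_surjective (LinearMap.surjective_of_ne_zero hf)).sup_eq_top_of_ne
      (LinearMap.isCoatom_ker_of_surjective (LinearMap.surjective_of_ne_zero hg)) hne
  have hsurj : Function.Surjective (f.prod g) := by
    rw [← LinearMap.range_eq_top, LinearMap.range_prod_eq hsup,
      LinearMap.range_eq_top.2 (LinearMap.surjective_of_ne_zero hf),
      LinearMap.range_eq_top.2 (LinearMap.surjective_of_ne_zero hg), Submodule.prod_top]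
  -- `h` acts as the identity on the quotient `S` and as zero on the quotient `S'`
  obtain ⟨h, hh⟩ := Module.projective_lifting_property (f.prod g) (f.prod (0 : M →ₗ[R] S')) hsurj
  have hhf : f ∘ₗ h = f := congrArg (LinearMap.fst R S S' ∘ₗ ·) hh
  have hhg : g ∘ₗ h = 0 := congrArg (LinearMap.snd R S S' ∘ₗ ·) hh
  obtain hu | hu := IsLocalRing.isUnit_or_isUnit_of_add_one (add_sub_cancel h (1 : Module.End R M))
  · apply hg
    obtain ⟨h', hh'⟩ := hu.exists_right_inv
    calc g = g ∘ₗ (h * h') := by rw [hh']; rfl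
      _ = (g ∘ₗ h) ∘ₗ h' := rfl
      _ = 0 := by rw [hhg, LinearMap.zero_comp]
  · apply hf
    obtain ⟨h', hh'⟩ := hu.exists_right_inv
    calc f = f ∘ₗ ((1 - h) * h') := by rw [hh']; rfl
      _ = (f - f ∘ₗ h) ∘ₗ h' := by ext; simp
      _ = 0 := by rw [hhf, sub_self, LinearMap.zero_comp]

/-- A projective module with local endomorphism ring is a projective cover of its simple
quotient. -/
theorem surjective_of_comp_ne_zero_of_isLocalRing_end [Module.Projective R M]
    [IsLocalRing (Module.End R M)] [Module.Finite R M] [IsSimpleModule R S] {f : M →ₗ[R] S}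
    {g : N →ₗ[R] M} (h : f ∘ₗ g ≠ 0) : Function.Surjective g := by
  rw [← LinearMap.range_eq_top]
  by_contra hg
  obtain ⟨m, hm, hle⟩ := (eq_top_or_exists_le_coatom (LinearMap.range g)).resolve_left hg
  have : IsSimpleModule R (M ⧸ m) := isSimpleModule_iff_isCoatom.2 hm
  have hf : f ≠ 0 := by rintro rfl; exact h (LinearMap.zero_comp g)
  have hm0 : m.mkQ ≠ 0 := fun h0 => hm.1 (by rw [← m.ker_mkQ, h0, LinearMap.ker_zero])
  rw [← m.ker_mkQ, ker_eq_ker_of_isLocalRing_end hm0 hf] at hle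
  exact h (LinearMap.range_le_ker_iff.1 hle)

/-- A projective module with local endomorphism ring is determined by its simple quotient. -/
theorem nonempty_linearEquiv_of_isLocalRing_end [Module.Projective R M] [Module.Projective R N]
    [IsLocalRing (Module.End R M)] [IsLocalRing (Module.End R N)] [IsNoetherian R M]
    [IsNoetherian R N] [IsSimpleModule R S] {f : M →ₗ[R] S} {g : N →ₗ[R] S} (hf : f ≠ 0)
    (hg : g ≠ 0) : Nonempty (M ≃ₗ[R] N) := by
  obtain ⟨a, ha⟩ := Module.projective_lifting_property g f (LinearMap.surjective_of_ne_zero hg)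
  obtain ⟨b, hb⟩ := Module.projective_lifting_property f g (LinearMap.surjective_of_ne_zero hf)
  have hsa : Function.Surjective a :=
    surjective_of_comp_ne_zero_of_isLocalRing_end (f := g) (by rwa [ha])
  have hsb : Function.Surjective b :=
    surjective_of_comp_ne_zero_of_isLocalRing_end (f := f) (by rwa [hb])
  have : Function.Injective (b ∘ₗ a) :=
    IsNoetherian.injective_of_surjective_endomorphism _ (hsb.comp hsa)
  exact ⟨LinearEquiv.ofBijective a ⟨Function.Injective.of_comp (f := b) this, hsa⟩⟩

end Indecomposable

/-! ### Decomposition of algebras into local algebras up to Morita equivalence -/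

instance MulOpposite.isLocalRing (R : Type*) [Semiring R] [IsLocalRing R] : IsLocalRing Rᵐᵒᵖ where
  isUnit_or_isUnit_of_add_one {a b} h := by
    rw [← isUnit_unop, ← isUnit_unop]
    exact IsLocalRing.isUnit_or_isUnit_of_add_one (congrArg MulOpposite.unop h)

section

variable {k R : Type*} [CommSemiring k] [Ring R] [Algebra k R] {ι : Type*}

/-- Families of endomorphisms act diagonally on the product. -/
def Module.End.piAlgHom (M : ι → Type*) [∀ i, AddCommGroup (M i)] [∀ i, Module k (M i)]
    [∀ i, Module R (M i)] [∀ i, IsScalarTower k R (M i)] :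
    (∀ i, Module.End R (M i)) →ₐ[k] Module.End R (∀ i, M i) where
  toFun f := LinearMap.piMap f
  map_one' := rfl
  map_mul' _ _ := rfl
  map_zero' := rfl
  map_add' _ _ := rfl
  commutes' _ := rfl

/-- The endomorphism algebra of a finite direct sum of pairwise orthogonal modules. -/
noncomputable def Module.End.piAlgEquivOfOrthogonal [Finite ι] [DecidableEq ι] (M : ι → Type*)
    [∀ i, AddCommGroup (M i)] [∀ i, Module k (M i)] [∀ i, Module R (M i)]
    [∀ i, IsScalarTower k R (M i)]
    (h : ∀ i j, i ≠ j → ∀ f : M i →ₗ[R] M j, f = 0) :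
    (∀ i, Module.End R (M i)) ≃ₐ[k] Module.End R (∀ i, M i) :=
  AlgEquiv.ofBijective (Module.End.piAlgHom M) <| by
    refine ⟨fun f g hfg => ?_, fun f =>
      ⟨fun i => LinearMap.proj i ∘ₗ f ∘ₗ LinearMap.single R M i, ?_⟩⟩
    · ext i x
      have : f i ((Pi.single i x : ∀ i, M i) i) = g i ((Pi.single i x : ∀ i, M i) i) :=
        congrFun (LinearMap.congr_fun hfg (Pi.single i x)) i
      simpa using this
    · ext i x j
      change f (Pi.single j ((Pi.single i x : ∀ i, M i) j)) j = f (Pi.single i x) j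
      by_cases hij : i = j
      · subst hij
        simp
      · have : f (Pi.single i x) j = 0 := LinearMap.congr_fun
          (h i j hij (LinearMap.proj j ∘ₗ f ∘ₗ LinearMap.single R M i)) x
        simp [this, Pi.single_eq_of_ne (Ne.symm hij)]

/-- Regrouping of a product along a map `c`, when its factors only depend on `c` up to
isomorphism. -/
def LinearEquiv.piFiberwise {κ : Type*} (c : ι → κ) {M : ι → Type*} {N : κ → Type*}
    [∀ i, AddCommGroup (M i)] [∀ i, Module R (M i)] [∀ y, AddCommGroup (N y)] [∀ y, Module R (N y)]
    (e : ∀ i, M i ≃ₗ[R] N (c i)) : (∀ i, M i) ≃ₗ[R] ∀ y, {i // c i = y} → N y where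
  toFun v y i := i.2 ▸ e i.1 (v i.1)
  invFun w i := (e i).symm (w (c i) ⟨i, rfl⟩)
  left_inv v := by simp
  right_inv w := by
    ext y ⟨i, rfl⟩
    simp
  map_add' v w := by
    ext y ⟨i, rfl⟩
    simp
  map_smul' a v := by
    ext y ⟨i, rfl⟩
    simp

end

/-- If the indecomposable projective modules are pairwise isomorphic or orthogonal, the algebra is
Morita equivalent to the product of their opposite endomorphism algebras, which are local. -/
theorem exists_isMoritaEquivalent_pi_isLocalRing (k : Type v) [Field k] (A : Type u) [Ring A]
    [Algebra k A] [FiniteDimensional k A]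
    (h : ∀ P Q : Submodule A A, Module.Projective A P → Module.Projective A Q →
      IsLocalRing (Module.End A P) → IsLocalRing (Module.End A Q) → IsEmpty (P ≃ₗ[A] Q) →
      ∀ f : P →ₗ[A] Q, f = 0) :
    ∃ (n : ℕ) (B : Fin n → Type u) (_ : ∀ i, Ring (B i)) (_ : ∀ i, Algebra k (B i))
      (_ : ∀ i, FiniteDimensional k (B i)),
      (∀ i, IsLocalRing (B i)) ∧ IsMoritaEquivalent k A (∀ i, B i) := by
  classical
  have : IsNoetherianRing A := IsNoetherianRing.of_finite k A
  have : IsArtinianRing A := IsArtinianRing.of_finite k A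
  obtain ⟨ι, _, P, hP, ⟨e⟩⟩ := exists_linearEquiv_pi_isIndecomposable A A
  have hloc : ∀ i, IsLocalRing (Module.End A (P i)) := fun i => (hP i).isLocalRing_end
  have hproj : ∀ i, Module.Projective A (P i) := fun i => by
    refine Module.Projective.of_split (e.symm.toLinearMap ∘ₗ LinearMap.single A (fun i => P i) i)
      (LinearMap.proj i ∘ₗ e.toLinearMap) ?_
    ext x
    simp
  let s : Setoid ι :=
    { r := fun i j => Nonempty (P i ≃ₗ[A] P j)
      iseqv := ⟨fun i => ⟨.refl A _⟩, fun ⟨e⟩ => ⟨e.symm⟩, fun ⟨e⟩ ⟨e'⟩ => ⟨e.trans e'⟩⟩ }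
  let t := Fintype.equivFin (Quotient s)
  let c : ι → Fin (Fintype.card (Quotient s)) := fun i => t (Quotient.mk s i)
  let r : Fin (Fintype.card (Quotient s)) → ι := fun y => (t.symm y).out
  have hcr : ∀ y, c (r y) = y := fun y => by simp [c, r]
  have hrc : ∀ i, Nonempty (P i ≃ₗ[A] P (r (c i))) := fun i => by
    refine Quotient.exact (s := s) ?_
    simp [c, r]
  let e' : A ≃ₗ[A] ∀ y, {i // c i = y} → P (r y) :=
    e.trans (LinearEquiv.piFiberwise c (M := fun i => P i) (N := fun y => P (r y))
      fun i => (hrc i).some)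
  have horth : ∀ y z, y ≠ z →
      ∀ f : ({i // c i = y} → P (r y)) →ₗ[A] ({i // c i = z} → P (r z)), f = 0 := by
    intro y z hyz f
    have hempty : IsEmpty (P (r y) ≃ₗ[A] P (r z)) := ⟨fun g => hyz (by
      rw [← hcr y, ← hcr z]
      exact congrArg t (Quotient.sound (s := s) ⟨g⟩))⟩
    ext i x j
    have := h _ _ (hproj (r y)) (hproj (r z)) (hloc _) (hloc _) hempty
      (LinearMap.proj j ∘ₗ f ∘ₗ LinearMap.single A (fun _ => P (r y)) i)
    simpa using congrArg Subtype.val (LinearMap.congr_fun this x)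
  let ψ : A ≃ₐ[k] ∀ y, Matrix {i // c i = y} {i // c i = y} (Module.End A (P (r y)))ᵐᵒᵖ :=
    (AlgEquiv.opOp k A).trans <| .trans (.op <| (AlgEquiv.moduleEndSelf k).trans <|
      (e'.conjAlgEquiv k).trans <| (Module.End.piAlgEquivOfOrthogonal _ horth).symm.trans <|
      AlgEquiv.piCongrRight fun y => endVecAlgEquivMatrixEnd _ k A _) <|
      (AlgEquiv.piMulOpposite k _).trans <| AlgEquiv.piCongrRight fun y => .symm .mopMatrix
  refine ⟨Fintype.card (Quotient s), fun y => (Module.End A (P (r y)))ᵐᵒᵖ, inferInstance,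
    inferInstance, fun y => inferInstance, fun y => inferInstance, ?_⟩
  refine (IsMoritaEquivalent.of_algEquiv k ψ).trans k (IsMoritaEquivalent.pi fun y => ?_)
  have : Nonempty {i // c i = y} := ⟨⟨r y, hcr y⟩⟩
  exact (IsMoritaEquivalent.matrix _ k).symm k

/-! ### Distributivity -/

theorem hasDistributiveThickDb_iff_of_isMoritaEquivalent_pi {k : Type v} [Field k] {A : Type u}
    [Ring A] [Algebra k A] [FiniteDimensional k A] {n : ℕ} {B : Fin n → Type u} [∀ i, Ring (B i)]
    [∀ i, Algebra k (B i)] [∀ i, FiniteDimensional k (B i)]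
    (h : IsMoritaEquivalent k A (∀ i, B i)) :
    HasDistributiveThickDb k A ↔ ∀ i, HasDistributiveThickDb k (B i) := by
  have : IsNoetherianRing A := IsNoetherianRing.of_finite k A
  have : ∀ i, IsNoetherianRing (B i) := fun i => IsNoetherianRing.of_finite k (B i)
  have : IsNoetherianRing (∀ i, B i) := IsNoetherianRing.of_finite k _
  obtain ⟨E⟩ := h.cond
  obtain ⟨e⟩ := nonempty_thick_orderIso_of_equivalence E.eqv
  let e' := e.trans PiModule.thickOrderIso
  exact ⟨fun hD => isDistributiveLattice_pi_iff.1 (IsDistributiveLattice.of_orderIso e' hD),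
    fun hD => IsDistributiveLattice.of_orderIso e'.symm (isDistributiveLattice_pi_iff.2 hD)⟩

/-- When `Thick(D^b(A))` is distributive, non-isomorphic indecomposable projective modules are
orthogonal. -/
theorem linearMap_eq_zero_of_hasDistributiveThickDb {k : Type v} [Field k] {A : Type u} [Ring A]
    [Algebra k A] [FiniteDimensional k A] (hD : HasDistributiveThickDb k A)
    {P Q : Submodule A A} [Module.Projective A P] [Module.Projective A Q]
    [IsLocalRing (Module.End A P)] [IsLocalRing (Module.End A Q)] (h : IsEmpty (P ≃ₗ[A] Q))
    (f : P →ₗ[A] Q) : f = 0 := by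
  have : IsNoetherianRing A := IsNoetherianRing.of_finite k A
  have : IsArtinianRing A := IsArtinianRing.of_finite k A
  have : Nontrivial Q := not_subsingleton_iff_nontrivial.1 fun _ =>
    one_ne_zero (α := Module.End A Q) (Subsingleton.elim _ _)
  -- a simple quotient `Q ⧸ m` of `Q`
  obtain ⟨m, hm, -⟩ := (eq_top_or_exists_le_coatom (⊥ : Submodule A Q)).resolve_left bot_ne_top
  have : IsSimpleModule A (Q ⧸ m) := isSimpleModule_iff_isCoatom.2 hm
  have hm0 : m.mkQ ≠ 0 := fun h0 => hm.1 (by rw [← m.ker_mkQ, h0, LinearMap.ker_zero])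
  refine linearMap_eq_zero_of_isDistributiveLattice hD (S := Q ⧸ m) ?_ ?_ f
  · intro S' _ _ _ hS' g
    by_contra hg
    have e := (LinearMap.quotKerEquivOfSurjective g (LinearMap.surjective_of_ne_zero hg))
    rw [ker_eq_ker_of_isLocalRing_end hg hm0, m.ker_mkQ] at e
    exact hS'.false e.symm
  · intro g
    by_contra hg
    exact not_isEmpty_iff.2 (nonempty_linearEquiv_of_isLocalRing_end hg hm0) h

theorem mainTheorem4 (k : Type v) [Field k] [IsAlgClosed k]
    (A : Type u) [Ring A] [Algebra k A] [FiniteDimensional k A] :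
    HasDistributiveThickDb k A ↔
      ∃ (n : ℕ) (B : Fin n → Type u) (_ : ∀ i, Ring (B i)) (_ : ∀ i, Algebra k (B i))
        (_ : ∀ i, FiniteDimensional k (B i)),
        (∀ i, IsLocalRing (B i)) ∧
        IsMoritaEquivalent k A (∀ i, B i) ∧
        ∀ i, HasDistributiveThickDb k (B i) := by
  constructor
  · intro hD
    obtain ⟨n, B, _, _, _, hB, hAB⟩ := exists_isMoritaEquivalent_pi_isLocalRing k A
      fun P Q _ _ _ _ h f => linearMap_eq_zero_of_hasDistributiveThickDb hD h f
    exact ⟨n, B, _, _, ‹_›, hB, hAB,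
      (hasDistributiveThickDb_iff_of_isMoritaEquivalent_pi hAB).1 hD⟩
  · rintro ⟨n, B, _, _, _, -, hAB, hD⟩
    exact (hasDistributiveThickDb_iff_of_isMoritaEquivalent_pi hAB).2 hD
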